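/- Consider a wireless network with one transmitter–receiver pair and $R$ parallel amplify-and-forward relays. The channels $f_r\sim\mathcal{CN}(0,\sigma_{f_r}^2)$ (transmitter to relay $r$) and $g_r\sim\mathcal{CN}(0,\sigma_{g_r}^2)$ (relay $r$ to receiver), $r=1,\dots,R$, are independent with $\sigma_{f_r},\sigma_{g_r}>0$, where a $\mathcal{CN}(0,\sigma^2)$ variable has independent real and imaginary parts, each centred Gaussian of variance $\sigma^2/2$; put $\mathbf h=(f_1,g_1,\dots,f_R,g_R)$. For fixed $p_0,\dots,p_R>0$ and a power level $P>0$ let $P_i=p_iP$, $\rho_r=P_r/(1+|f_r|^2P_0)$, and, for a beamforming vector $\mathbf x\in\mathbb C^R$, $$\mathrm{SNR}_P(\mathbf x,\mathbf h)=\frac{P_0\left|\sum_{r=1}^R x_rf_rg_r\sqrt{\rho_r}\right|^2}{1+\sum_{r=1}^R|x_r|^2|g_r|^2\rho_r}.$$ A power-dependent codebook $\mathcal D$ assigns to each $P>0$ a nonempty compact (finite or infinite) set $\mathcal D_P\subset\{\mathbf x\in\mathbb C^R:\max_r|x_r|=1\}$, all $\mathcal D_P$ having the same cardinality $|\mathcal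 D|\in\{1,2,\dots\}\cup\{\infty\}$. Let $\mathcal Q_P^\star(\mathbf h)$ be an element of $\mathcal D_P$ that maximizes $\mathrm{SNR}_P(\cdot,\mathbf h)$ over $\mathcal D_P$, let $$\mathrm{SER}_P=\mathrm E_{\mathbf h}\left[\mathrm Q\left(\sqrt{2\,\mathrm{SNR}_P(\mathcal Q_P^\star(\mathbf h),\mathbf h)}\right)\right],$$ where $\mathrm Q$ is the tail function of the standard Gaussian distribution, and let the diversity of $\mathcal D$ be $$\mathsf d(\mathcal D)=\lim_{P\to\infty}-\frac{\log \mathrm{SER}_P}{\log P}$$ whenever this limit exists in $[-\infty,\infty]$. Theorem. For every power-dependent codebook $\mathcal D$, $\mathsf d(\mathcal D)\le\min\{R,|\mathcal D|\}$. If the limit is not assumed to exist, the bound holds with $\limsup$ in place of $\lim$. In particular, a small codebook ($|\mathcal D|<R$) cannot achieve more diversity than its cardinality. -/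

import Mathlib

open MeasureTheory ProbabilityTheory Filter Topology

noncomputable section

namespace RelayBeamforming

/-- The fixed parameters of a network with one transmitter-receiver pair and `R` parallel
amplify-and-forward relays: the standard deviations `σf r`, `σg r` of the channels
transmitter → relay `r` and relay `r` → receiver, and the power constraint scalers `p0`
(transmitter) and `p r` (relay `r`). All of them are positive. -/
structure Network (R : ℕ) where
  σf : Fin R → ℝ
  σg : Fin R → ℝ
  p0 : ℝ
  p : Fin R → ℝ
  σf_pos : ∀ r, 0 < σf r
  σg_pos : ∀ r, 0 < σg r
  p0_pos : 0 < p0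
  p_pos : ∀ r, 0 < p r

/-- Beamforming vectors, elements of `ℂ^R`. The norm of this type is the infinity norm. -/
abbrev Beam (R : ℕ) : Type := Fin R → ℂ

/-- Channel states `h = (f, g)`, with `f, g ∈ ℂ^R`. -/
abbrev Channel (R : ℕ) : Type := (Fin R → ℂ) × (Fin R → ℂ)

/-- The law `CN(0, σ²)` of a circularly symmetric complex Gaussian variable: real and imaginary
parts are independent, each centred Gaussian with variance `σ² / 2`. -/
def complexGaussian (σ : ℝ) : Measure ℂ :=
  ((gaussianReal 0 (Real.toNNReal (σ ^ 2 / 2))).prod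
    (gaussianReal 0 (Real.toNNReal (σ ^ 2 / 2)))).map (fun z : ℝ × ℝ => (⟨z.1, z.2⟩ : ℂ))

/-- The Gaussian tail function `Q(x) = Pr(N(0,1) > x)`. -/
def gaussianTail (x : ℝ) : ℝ := (gaussianReal 0 1).real (Set.Ioi x)

namespace Network

variable {R : ℕ} (N : Network R)

/-- The law of the channel state: all `2R` entries are independent, `f r ∼ CN(0, (σf r)²)` and
`g r ∼ CN(0, (σg r)²)`. -/
def channelLaw : Measure (Channel R) :=
  (Measure.pi fun r => complexGaussian (N.σf r)).prod
    (Measure.pi fun r => complexGaussian (N.σg r))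

/-- The relay normalization factor `ρ_r = P_r / (1 + |f_r|² P_0)`, with `P_0 = p_0 P` and
`P_r = p_r P`. -/
def rho (P : ℝ) (h : Channel R) (r : Fin R) : ℝ :=
  (N.p r * P) / (1 + ‖h.1 r‖ ^ 2 * (N.p0 * P))

/-- The received signal-to-noise ratio with beamforming vector `x` in channel state `h`. -/
def snr (P : ℝ) (x : Beam R) (h : Channel R) : ℝ :=
  (N.p0 * P) * ‖∑ r, x r * h.1 r * h.2 r * (Real.sqrt (N.rho P h r) : ℂ)‖ ^ 2 /
    (1 + ∑ r, ‖x r‖ ^ 2 * ‖h.2 r‖ ^ 2 * N.rho P h r)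

/-- The symbol error rate (binary constellation) at power level `P` of the quantizer `q`, that is,
of the map which sends a channel state to the beamforming vector used in that state. -/
def ser (P : ℝ) (q : Channel R → Beam R) : ℝ :=
  ∫ h, gaussianTail (Real.sqrt (2 * N.snr P (q h) h)) ∂N.channelLaw

/-- `q` is an optimal quantizer for the codebook `C` at power level `P`: for every channel state
it selects an element of `C` that maximizes the SNR over `C`. -/
def IsOptimalQuantizer (P : ℝ) (C : Set (Beam R)) (q : Channel R → Beam R) : Prop :=
  ∀ h, q h ∈ C ∧ ∀ y ∈ C, N.snr P y h ≤ N.snr P (q h) h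

/-- The quotient `-log SER_P / log P` whose limit as `P → ∞` is the diversity of the collection
`q` of quantizers. -/
def diversityRatio (q : ℝ → Channel R → Beam R) (P : ℝ) : EReal :=
  ((-Real.log (N.ser P (q P)) / Real.log P : ℝ) : EReal)

/-- The collection `q` of quantizers has diversity `d`, i.e. the limit that defines the diversity
exists in the extended reals and equals `d`. -/
def HasDiversity (q : ℝ → Channel R → Beam R) (d : EReal) : Prop :=
  Tendsto (N.diversityRatio q) atTop (𝓝 d)

/-- The upper limit in place of the limit. It exists always, and is the diversity whenever the
latter exists. -/
def upperDiversity (q : ℝ → Channel R → Beam R) : EReal :=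
  limsup (N.diversityRatio q) atTop

end Network

/-- A power-dependent codebook: for every power level `P > 0` a nonempty compact (finite or
infinite) set of beamforming vectors of infinity norm one, whose cardinality does not depend
on `P`. -/
structure DCodebook (R : ℕ) where
  book : ℝ → Set (Beam R)
  nonempty : ∀ P, 0 < P → (book P).Nonempty
  isCompact : ∀ P, 0 < P → IsCompact (book P)
  norm_eq_one : ∀ P, 0 < P → ∀ x ∈ book P, ‖x‖ = 1
  encard_eq : ∀ P P', 0 < P → 0 < P' → (book P).encard = (book P').encard

/-- The common cardinality `|D|` of the codebooks `D_P`, `P > 0` (`⊤` if they are infinite). -/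
def DCodebook.card {R : ℕ} (D : DCodebook R) : ℕ∞ := (D.book 1).encard

/-- `q` is a collection of optimal quantizers for the power-dependent codebook `D`. -/
def IsOptimalCollection {R : ℕ} (N : Network R) (D : DCodebook R)
    (q : ℝ → Channel R → Beam R) : Prop :=
  ∀ P, 0 < P → N.IsOptimalQuantizer P (D.book P) (q P)

theorem Network.continuous_snr {R : ℕ} (N : Network R) {P : ℝ} (hP : 0 < P) (h : Channel R) :
    Continuous fun x : Beam R => N.snr P x h := by
  have hρ : ∀ r, 0 ≤ N.rho P h r := fun r => by
    have h1 := N.p_pos r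
    have h2 := N.p0_pos
    unfold Network.rho
    positivity
  unfold Network.snr
  refine Continuous.div (by fun_prop) (by fun_prop) fun x => ?_
  have : 0 ≤ ∑ r, ‖x r‖ ^ 2 * ‖h.2 r‖ ^ 2 * N.rho P h r :=
    Finset.sum_nonneg fun r _ => mul_nonneg (by positivity) (hρ r)
  positivity

/-- Every power-dependent codebook has a collection of optimal quantizers. -/
theorem DCodebook.exists_isOptimalCollection {R : ℕ} (N : Network R) (D : DCodebook R) :
    ∃ q, IsOptimalCollection N D q := by
  have key : ∀ P : ℝ, ∀ h : Channel R, ∃ x : Beam R, 0 < P →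
      x ∈ D.book P ∧ ∀ y ∈ D.book P, N.snr P y h ≤ N.snr P x h := by
    intro P h
    by_cases hP : 0 < P
    · obtain ⟨x, hx, hmax⟩ := (D.isCompact P hP).exists_isMaxOn (D.nonempty P hP)
        (N.continuous_snr hP h).continuousOn
      exact ⟨x, fun _ => ⟨hx, fun y hy => hmax hy⟩⟩
    · exact ⟨0, fun h => absurd h hP⟩
  choose q hq using key
  exact ⟨q, fun P hP h => hq P h hP⟩

end RelayBeamforming

end

noncomputable section

namespace RelayBeamforming

open scoped ENNReal NNReal

/-! Given `f`, the signal received with a fixed beamforming vector is a complex linear form in `g`,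
whose coefficients stay bounded in `f` and `P` because the relays normalize their input
(`norm_sq_mul_rho_le`). If `k` such signals are at most `P ^ (-1/2)`, the factor `P` in the SNR
cancels and every vector they control has bounded SNR, hence error probability bounded below. This
event has probability at least of order `P ^ (-k)`: it asks `2 * k` real functionals to be of size
`P ^ (-1/2)`. So the SER is at least `c / P ^ k` (`exists_le_ser`). The two bounds differ only in
the controlling vectors: the standard basis (`k = R`), or the codebook itself (`k = |D|`). As the
codebook varies with `P`, `c` must not depend on the vectors, which may be nearly dependent. The
pigeonhole bound `measure_closedBall_le_mul` gives this uniformity without any determinant. -/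

/-! ### Gaussian laws dominate multiples of Lebesgue measure on balls -/

/-- Products of measures are monotone, up to constant factors. -/
theorem smul_pi_le_pi {ι : Type*} [Fintype ι] {α : ι → Type*} [∀ i, MeasurableSpace (α i)]
    {μ ν : ∀ i, Measure (α i)} [∀ i, SigmaFinite (ν i)] {a : ι → ℝ≥0∞}
    (h : ∀ i, a i • ν i ≤ μ i) : (∏ i, a i) • Measure.pi ν ≤ Measure.pi μ := by
  refine Measure.le_iff.2 fun s hs => ?_
  -- `OuterMeasure.pi` is the largest outer measure bounded by the product on boxes, so boxes
  -- suffice.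
  have key : ((∏ i, a i) • Measure.pi ν).toOuterMeasure ≤
      OuterMeasure.pi fun i => (μ i).toOuterMeasure := by
    refine OuterMeasure.le_pi.2 fun t _ => ?_
    simp only [Measure.coe_toOuterMeasure, Measure.smul_apply, Measure.pi_pi, smul_eq_mul,
      ← Finset.prod_mul_distrib]
    exact Finset.prod_le_prod' fun i _ => by simpa using h i (t i)
  have := key s
  have hpi : Measure.pi μ s = OuterMeasure.pi (fun i => (μ i).toOuterMeasure) s := by
    rw [Measure.pi, toMeasure_apply _ _ hs]
  rw [hpi]
  exact this

/-- The Gaussian density is bounded below on bounded intervals. -/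
theorem exists_smul_restrict_le_gaussianReal {v : ℝ≥0} (hv : v ≠ 0) (b : ℝ) :
    ∃ a : ℝ≥0∞, a ≠ 0 ∧ a • volume.restrict (Set.Icc (-b) b) ≤ gaussianReal 0 v := by
  -- The centred density decreases in `|x|`, so its minimum on the interval is its value at `b`.
  refine ⟨gaussianPDF 0 v b, (gaussianPDF_pos 0 hv b).ne', Measure.le_iff.2 fun s hs => ?_⟩
  rw [gaussianReal_apply _ hv, Measure.smul_apply, Measure.restrict_apply hs, smul_eq_mul]
  calc gaussianPDF 0 v b * volume (s ∩ Set.Icc (-b) b)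
      = ∫⁻ _ in s ∩ Set.Icc (-b) b, gaussianPDF 0 v b := by simp
    _ ≤ ∫⁻ x in s ∩ Set.Icc (-b) b, gaussianPDF 0 v x := by
        refine setLIntegral_mono' (hs.inter measurableSet_Icc) fun x hx => ?_
        refine ENNReal.ofReal_le_ofReal ?_
        unfold gaussianPDFReal
        have : x ^ 2 ≤ b ^ 2 := sq_le_sq' hx.2.1 hx.2.2
        simp only [sub_zero]
        gcongr
    _ ≤ ∫⁻ x in s, gaussianPDF 0 v x := lintegral_mono_set Set.inter_subset_left

/-- The disc lies in the square of half-side `b`, where the bounds for the real and imaginary parts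
multiply. -/
theorem exists_smul_restrict_le_complexGaussian {σ : ℝ} (hσ : 0 < σ) (b : ℝ) :
    ∃ a : ℝ≥0∞, a ≠ 0 ∧
      a • volume.restrict (Metric.closedBall 0 b) ≤ complexGaussian σ := by
  have hv : Real.toNNReal (σ ^ 2 / 2) ≠ 0 := by
    simpa using by positivity
  obtain ⟨a, ha, hle⟩ := exists_smul_restrict_le_gaussianReal hv b
  refine ⟨a * a, mul_ne_zero ha ha, Measure.le_iff.2 fun s hs => ?_⟩
  have hprod := Measure.prod_mono hle hle
  rw [Measure.prod_smul_left, Measure.prod_smul_right, smul_smul, Measure.prod_restrict] at hprod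
  have he : (fun z : ℝ × ℝ => (⟨z.1, z.2⟩ : ℂ)) = Complex.measurableEquivRealProd.symm := rfl
  rw [complexGaussian, he, MeasurableEquiv.map_apply]
  refine le_trans ?_ (hprod _)
  have hs' := Complex.measurableEquivRealProd.symm.measurable hs
  rw [Measure.smul_apply, Measure.smul_apply, Measure.restrict_apply hs,
    Measure.restrict_apply hs', ← Measure.volume_eq_prod,
    ← (Complex.volume_preserving_equiv_real_prod.symm _).measure_preimage_equiv]
  rw [smul_eq_mul, smul_eq_mul]
  gcongr
  rintro z ⟨hz, hz'⟩
  refine ⟨hz, ?_⟩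
  rw [mem_closedBall_zero_iff] at hz'
  have h1 := (Complex.abs_re_le_norm _).trans hz'
  have h2 := (Complex.abs_im_le_norm _).trans hz'
  exact ⟨abs_le.1 h1, abs_le.1 h2⟩

theorem exists_smul_restrict_le_pi_complexGaussian {R : ℕ} {σ : Fin R → ℝ} (hσ : ∀ r, 0 < σ r)
    {b : ℝ} (hb : 0 ≤ b) :
    ∃ a : ℝ≥0∞, a ≠ 0 ∧ a • (volume : Measure (Fin R → ℂ)).restrict (Metric.closedBall 0 b) ≤
      Measure.pi fun r => complexGaussian (σ r) := by
  choose a ha hle using fun r => exists_smul_restrict_le_complexGaussian (hσ r) b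
  refine ⟨∏ r, a r, Finset.prod_ne_zero_iff.2 fun r _ => ha r, ?_⟩
  have := smul_pi_le_pi hle
  rw [← Measure.restrict_pi_pi] at this
  rwa [closedBall_pi _ hb]

/-! ### Small-ball probabilities of linear forms -/

/-- Pigeonhole principle: finitely many bounded additive functionals are simultaneously small on a
set whose measure is bounded below. -/
theorem measure_closedBall_le_mul {E κ : Type*} [NormedAddCommGroup E] [MeasurableSpace E]
    [MeasurableAdd E] [Fintype κ] (μ : Measure E) [μ.IsAddLeftInvariant] (u : κ → E →+ ℝ)
    {K ε : ℝ} (hε : 0 < ε) (hu : ∀ j, ∀ g ∈ Metric.closedBall (0 : E) 1, |u j g| ≤ K) :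
    μ (Metric.closedBall 0 1) ≤ ((2 * ⌈K / ε⌉₊ + 1) ^ Fintype.card κ : ℕ) *
      μ {g | g ∈ Metric.closedBall 0 2 ∧ ∀ j, |u j g| ≤ ε} := by
  classical
  set n := ⌈K / ε⌉₊
  set S := {g | g ∈ Metric.closedBall (0 : E) 2 ∧ ∀ j, |u j g| ≤ ε}
  -- Cells of width `ε` for each functional; those meeting the unit ball have labels in `[-n, n]`.
  let F : E → κ → ℤ := fun g j => ⌊u j g / ε⌋
  let T : Finset (κ → ℤ) := Fintype.piFinset fun _ => Finset.Icc (-n : ℤ) n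
  have hT : T.card = (2 * n + 1) ^ Fintype.card κ := by
    simp only [T, Fintype.card_piFinset, Finset.prod_const, Int.card_Icc, Finset.card_univ]
    congr 1
    omega
  have hcell : ∀ t, μ (Metric.closedBall 0 1 ∩ F ⁻¹' {t}) ≤ μ S := by
    intro t
    rcases (Metric.closedBall (0 : E) 1 ∩ F ⁻¹' {t}).eq_empty_or_nonempty with h | ⟨g₀, hg₀, ht₀⟩
    · simp [h]
    -- Two points of a cell in the unit ball differ by an element of `S`, so a translate of `S`
    -- covers the cell.
    rw [← measure_preimage_add μ (-g₀) S]
    refine measure_mono ?_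
    rintro g ⟨hg, ht⟩
    rw [mem_closedBall_zero_iff] at hg hg₀
    refine ⟨?_, fun j => ?_⟩
    · rw [mem_closedBall_zero_iff]
      calc ‖-g₀ + g‖ ≤ ‖-g₀‖ + ‖g‖ := norm_add_le _ _
        _ ≤ 2 := by rw [norm_neg]; linarith
    · have h1 : ⌊u j g / ε⌋ = ⌊u j g₀ / ε⌋ := by
        have := (Set.mem_singleton_iff.1 ht).trans (Set.mem_singleton_iff.1 ht₀).symm
        exact congrFun this j
      have h2 := (Int.abs_sub_lt_one_of_floor_eq_floor h1).le
      rw [← sub_div, abs_div, abs_of_pos hε, div_le_one hε] at h2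
      rwa [map_add, map_neg, neg_add_eq_sub]
  calc μ (Metric.closedBall 0 1)
      ≤ μ (⋃ t ∈ T, Metric.closedBall 0 1 ∩ F ⁻¹' {t}) := by
        refine measure_mono fun g hg => ?_
        simp only [Set.mem_iUnion]
        refine ⟨F g, Fintype.mem_piFinset.2 fun j => Finset.mem_Icc.2 ?_, hg, rfl⟩
        have h1 : |u j g / ε| ≤ n := by
          rw [abs_div, abs_of_pos hε]
          exact (div_le_div_of_nonneg_right (hu j g hg) hε.le).trans (Nat.le_ceil _)
        obtain ⟨h2, h3⟩ := abs_le.1 h1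
        refine ⟨Int.le_floor.2 (by push_cast; exact h2), ?_⟩
        have := (Int.floor_le (u j g / ε)).trans h3
        exact_mod_cast this
    _ ≤ ∑ t ∈ T, μ (Metric.closedBall 0 1 ∩ F ⁻¹' {t}) := measure_biUnion_finset_le _ _
    _ ≤ ∑ _t ∈ T, μ S := Finset.sum_le_sum fun t _ => hcell t
    _ = _ := by rw [Finset.sum_const, hT, nsmul_eq_mul]

/-- The probability that `k` complex linear forms with bounded coefficients in independent complex
Gaussian variables are all at most `ε` is at least of the order `ε ^ (2 * k)`. -/
theorem exists_le_pi_complexGaussian {R : ℕ} {σ : Fin R → ℝ} (hσ : ∀ r, 0 < σ r) (k : ℕ)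
    {M : ℝ} (hM : 0 ≤ M) :
    ∃ c : ℝ≥0∞, c ≠ 0 ∧ ∀ ε : ℝ, 0 < ε → ε ≤ 1 → ∀ l : Fin k → Fin R → ℂ,
      (∀ j r, ‖l j r‖ ≤ M) →
      c * ENNReal.ofReal (ε ^ (2 * k)) ≤
        (Measure.pi fun r => complexGaussian (σ r)) {g | ∀ j, ‖∑ r, l j r * g r‖ ≤ ε} := by
  obtain ⟨a, ha, hle⟩ := exists_smul_restrict_le_pi_complexGaussian hσ (b := 2) (by norm_num)
  set V := (volume : Measure (Fin R → ℂ)) (Metric.closedBall 0 1)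
  have hV : V ≠ 0 := (Metric.measure_closedBall_pos _ _ one_pos).ne'
  -- Chosen so that `2 * ⌈R * M / (ε / 2)⌉₊ + 1 ≤ C / ε` for `ε ≤ 1`; real and imaginary parts each
  -- get `ε / 2`.
  set C : ℝ := 4 * (R * M) + 3
  have hC : 0 < C := by positivity
  refine ⟨a * (V * ENNReal.ofReal ((C ^ (2 * k))⁻¹)), ?_, ?_⟩
  · refine mul_ne_zero ha (mul_ne_zero hV ?_)
    rw [ne_eq, ENNReal.ofReal_eq_zero, not_le]
    positivity
  intro ε hε hε1 l hl
  let L : Fin k → (Fin R → ℂ) →+ ℂ := fun j =>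
    { toFun := fun g => ∑ r, l j r * g r
      map_zero' := by simp
      map_add' := fun g g' => by simp [mul_add, Finset.sum_add_distrib] }
  let u : Fin k ⊕ Fin k → (Fin R → ℂ) →+ ℝ := Sum.elim
    (fun j => Complex.reAddGroupHom.comp (L j)) (fun j => Complex.imAddGroupHom.comp (L j))
  have hL : ∀ j, ∀ g ∈ Metric.closedBall (0 : Fin R → ℂ) 1, ‖L j g‖ ≤ R * M := by
    intro j g hg
    rw [mem_closedBall_zero_iff] at hg
    calc ‖∑ r, l j r * g r‖ ≤ ∑ r, ‖l j r * g r‖ := norm_sum_le _ _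
      _ ≤ ∑ _r : Fin R, M := Finset.sum_le_sum fun r _ => by
          rw [norm_mul]
          exact (mul_le_mul (hl j r) ((norm_le_pi_norm g r).trans hg) (norm_nonneg _) hM).trans_eq
            (mul_one M)
      _ = R * M := by simp
  have hu : ∀ j, ∀ g ∈ Metric.closedBall (0 : Fin R → ℂ) 1, |u j g| ≤ R * M := by
    rintro (j | j) g hg
    · exact (Complex.abs_re_le_norm _).trans (hL j g hg)
    · exact (Complex.abs_im_le_norm _).trans (hL j g hg)
  have hp := measure_closedBall_le_mul volume u (half_pos hε) hu
  set S := {g : Fin R → ℂ | g ∈ Metric.closedBall 0 2 ∧ ∀ j, |u j g| ≤ ε / 2}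
  have hSsub : S ⊆ {g | ∀ j, ‖∑ r, l j r * g r‖ ≤ ε} := by
    intro g hg j
    have h1 : |(L j g).re| ≤ ε / 2 := hg.2 (Sum.inl j)
    have h2 : |(L j g).im| ≤ ε / 2 := hg.2 (Sum.inr j)
    calc ‖L j g‖ ≤ |(L j g).re| + |(L j g).im| := Complex.norm_le_abs_re_add_abs_im _
      _ ≤ ε := by linarith
  have hn : (((2 * ⌈R * M / (ε / 2)⌉₊ + 1) ^ Fintype.card (Fin k ⊕ Fin k) : ℕ) : ℝ≥0∞) ≤
      ENNReal.ofReal ((C / ε) ^ (2 * k)) := by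
    rw [← ENNReal.ofReal_natCast]
    refine ENNReal.ofReal_le_ofReal ?_
    rw [Fintype.card_sum, Fintype.card_fin, ← two_mul]
    push_cast
    refine pow_le_pow_left₀ (by positivity) ?_ _
    have h1 := Nat.ceil_lt_add_one (a := R * M / (ε / 2)) (by positivity)
    have h2 : C / ε = 2 * (R * M / (ε / 2)) + 3 / ε := by
      simp only [C]; field_simp; ring
    have h3 : 3 ≤ 3 / ε := by rw [le_div_iff₀ hε]; linarith
    linarith
  have hVS : V * ENNReal.ofReal ((C ^ (2 * k))⁻¹) * ENNReal.ofReal (ε ^ (2 * k)) ≤ volume S := by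
    rw [mul_assoc, ← ENNReal.ofReal_mul (by positivity)]
    calc V * ENNReal.ofReal ((C ^ (2 * k))⁻¹ * ε ^ (2 * k))
        ≤ ENNReal.ofReal ((C / ε) ^ (2 * k)) * volume S *
            ENNReal.ofReal ((C ^ (2 * k))⁻¹ * ε ^ (2 * k)) := by
          gcongr
          exact hp.trans (by gcongr)
      _ = volume S := by
          rw [mul_right_comm, ← ENNReal.ofReal_mul (by positivity)]
          have : (C / ε) ^ (2 * k) * ((C ^ (2 * k))⁻¹ * ε ^ (2 * k)) = 1 := by
            rw [div_pow]; field_simp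
          rw [this]; simp
  calc _ = a * (V * ENNReal.ofReal ((C ^ (2 * k))⁻¹) * ENNReal.ofReal (ε ^ (2 * k))) := by ring
    _ ≤ a * volume S := by gcongr
    _ = (a • (volume : Measure (Fin R → ℂ)).restrict (Metric.closedBall 0 2)) S := by
        rw [Measure.smul_apply, Measure.restrict_eq_self _ fun g hg => hg.1, smul_eq_mul]
    _ ≤ _ := hle S
    _ ≤ _ := measure_mono hSsub

instance isProbabilityMeasure_complexGaussian (σ : ℝ) :
    IsProbabilityMeasure (complexGaussian σ) :=
  Measure.isProbabilityMeasure_map (Complex.measurableEquivRealProd.symm.measurable).aemeasurable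

theorem gaussianTail_nonneg (x : ℝ) : 0 ≤ gaussianTail x := measureReal_nonneg

theorem gaussianTail_le_one (x : ℝ) : gaussianTail x ≤ 1 := measureReal_le_one

theorem gaussianTail_antitone : Antitone gaussianTail := fun _ _ h =>
  measureReal_mono (Set.Ioi_subset_Ioi h)

theorem gaussianTail_pos (x : ℝ) : 0 < gaussianTail x := by
  refine ENNReal.toReal_pos (fun h => ?_) (measure_ne_top _ _)
  have := gaussianReal_absolutelyContinuous' 0 one_ne_zero h
  simp at this

/-! ### SNR estimates and lower bounds for the SER -/

namespace Network

variable {R : ℕ} (N : Network R)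

instance : IsProbabilityMeasure N.channelLaw := by
  unfold channelLaw; infer_instance

theorem rho_nonneg {P : ℝ} (hP : 0 < P) (h : Channel R) (r : Fin R) : 0 ≤ N.rho P h r := by
  have h1 := N.p_pos r
  have h2 := N.p0_pos
  unfold rho
  positivity

theorem continuous_rho {P : ℝ} (hP : 0 < P) (r : Fin R) :
    Continuous fun h : Channel R => N.rho P h r := by
  have h2 := N.p0_pos
  unfold rho
  exact Continuous.div (by fun_prop) (by fun_prop) fun h => by positivity

/-- The noise term `1` in the denominator of `rho` can be dropped; what remains is independent of
`P` and `f`. -/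
theorem norm_sq_mul_rho_le {P : ℝ} (hP : 0 < P) (h : Channel R) (r : Fin R) :
    ‖h.1 r‖ ^ 2 * N.rho P h r ≤ N.p r / N.p0 := by
  have h1 := N.p_pos r
  have h2 := N.p0_pos
  unfold rho
  rw [← mul_div_assoc, div_le_div_iff₀ (by positivity) h2]
  nlinarith

theorem one_le_snr_denominator {P : ℝ} (hP : 0 < P) (x : Beam R) (h : Channel R) :
    1 ≤ 1 + ∑ r, ‖x r‖ ^ 2 * ‖h.2 r‖ ^ 2 * N.rho P h r := by
  have : 0 ≤ ∑ r, ‖x r‖ ^ 2 * ‖h.2 r‖ ^ 2 * N.rho P h r :=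
    Finset.sum_nonneg fun r _ => mul_nonneg (by positivity) (N.rho_nonneg hP h r)
  linarith

theorem continuous_snr_channel {P : ℝ} (hP : 0 < P) (x : Beam R) :
    Continuous fun h : Channel R => N.snr P x h := by
  have := N.continuous_rho hP
  unfold snr
  refine Continuous.div ?_ ?_ fun h => (one_pos.trans_le (N.one_le_snr_denominator hP x h)).ne'
  · fun_prop
  · fun_prop

theorem snr_le {P : ℝ} (hP : 0 < P) (x : Beam R) (h : Channel R) :
    N.snr P x h ≤
      (N.p0 * P) * ‖∑ r, x r * h.1 r * h.2 r * (Real.sqrt (N.rho P h r) : ℂ)‖ ^ 2 := by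
  have h2 := N.p0_pos
  exact div_le_self (by positivity) (N.one_le_snr_denominator hP x h)

/-- The maximal SNR over a codebook is a lower semicontinuous function of the channel state. -/
theorem measurable_snr_of_isOptimalQuantizer {P : ℝ} (hP : 0 < P) {C : Set (Beam R)}
    {q : Channel R → Beam R} (hq : N.IsOptimalQuantizer P C q) :
    Measurable fun h => N.snr P (q h) h := by
  refine measurable_of_Ioi fun a => IsOpen.measurableSet ?_
  -- The selection `q` need not be measurable, but the maximal value exceeds `a` exactly on a union
  -- of open sets, one for each codebook vector.
  have : (fun h => N.snr P (q h) h) ⁻¹' Set.Ioi a = ⋃ x ∈ C, {h | a < N.snr P x h} := by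
    ext h
    simp only [Set.mem_preimage, Set.mem_Ioi, Set.mem_iUnion, Set.mem_ofPred_eq, exists_prop]
    exact ⟨fun ha => ⟨q h, (hq h).1, ha⟩, fun ⟨x, hx, ha⟩ => ha.trans_le ((hq h).2 x hx)⟩
  rw [this]
  exact isOpen_biUnion fun x _ => isOpen_lt continuous_const (N.continuous_snr_channel hP x)

theorem integrable_gaussianTail_snr {P : ℝ} (hP : 0 < P) {C : Set (Beam R)}
    {q : Channel R → Beam R} (hq : N.IsOptimalQuantizer P C q) :
    Integrable (fun h => gaussianTail (Real.sqrt (2 * N.snr P (q h) h))) N.channelLaw := by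
  have hm : Measurable fun h => gaussianTail (Real.sqrt (2 * N.snr P (q h) h)) :=
    gaussianTail_antitone.measurable.comp
      ((N.measurable_snr_of_isOptimalQuantizer hP hq).const_mul 2).sqrt
  refine Integrable.of_bound hm.aestronglyMeasurable 1 (ae_of_all _ fun h => ?_)
  rw [Real.norm_of_nonneg (gaussianTail_nonneg _)]
  exact gaussianTail_le_one _

/-- With probability at least of the order `P ^ (-k)`, the signals received with any `k` given
beamforming vectors are all of the order `P ^ (-1/2)`. -/
theorem exists_le_channelLaw (k : ℕ) :
    ∃ c : ℝ, 0 < c ∧ ∀ P : ℝ, 1 ≤ P → ∀ y : Fin k → Beam R, (∀ j, ‖y j‖ ≤ 1) →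
      c / P ^ k ≤ N.channelLaw.real {h | ∀ j,
        ‖∑ r, y j r * h.1 r * h.2 r * (Real.sqrt (N.rho P h r) : ℂ)‖ ≤ 1 / Real.sqrt P} := by
  have h0 := N.p0_pos
  set M : ℝ := ∑ r, Real.sqrt (N.p r / N.p0)
  have hM : 0 ≤ M := Finset.sum_nonneg fun r _ => Real.sqrt_nonneg _
  obtain ⟨c, hc, hle⟩ := exists_le_pi_complexGaussian N.σg_pos k hM
  -- With zero forms and `ε = 1` the bound compares `c` with a probability.
  have hctop : c ≠ ⊤ := by
    have := (hle 1 one_pos le_rfl 0 (by simpa using fun _ _ => hM)).trans prob_le_one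
    rw [one_pow, ENNReal.ofReal_one, mul_one] at this
    exact ne_top_of_le_ne_top ENNReal.one_ne_top this
  refine ⟨c.toReal, ENNReal.toReal_pos hc hctop, fun P hP y hy => ?_⟩
  have hP0 : 0 < P := one_pos.trans_le hP
  set A := {h : Channel R | ∀ j,
        ‖∑ r, y j r * h.1 r * h.2 r * (Real.sqrt (N.rho P h r) : ℂ)‖ ≤ 1 / Real.sqrt P}
  have hA : MeasurableSet A := by
    have := N.continuous_rho hP0
    simp only [A, Set.ofPred_forall]
    refine MeasurableSet.iInter fun j => IsClosed.measurableSet ?_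
    exact isClosed_le (by fun_prop) continuous_const
  have key : c * ENNReal.ofReal ((1 / Real.sqrt P) ^ (2 * k)) ≤ N.channelLaw A := by
    -- Conditioning on `f`: the bound for `g` is uniform in `f`, so it survives integration.
    rw [channelLaw, Measure.prod_apply hA]
    calc c * ENNReal.ofReal ((1 / Real.sqrt P) ^ (2 * k))
        = ∫⁻ _ : Fin R → ℂ, c * ENNReal.ofReal ((1 / Real.sqrt P) ^ (2 * k))
            ∂(Measure.pi fun r => complexGaussian (N.σf r)) := by simp
      _ ≤ _ := lintegral_mono fun f => ?_
    -- the normalized relay gains `|f r| √(ρ r)` are bounded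
    let s : Fin R → ℝ := fun r => Real.sqrt (N.rho P (f, 0) r)
    refine (hle (1 / Real.sqrt P) (by positivity) ?_ (fun j r => y j r * f r * (s r : ℂ)) ?_).trans
      (measure_mono ?_)
    · rw [div_le_one (by positivity)]
      exact Real.one_le_sqrt.2 hP
    · intro j r
      have hs : ‖f r‖ * s r ≤ Real.sqrt (N.p r / N.p0) := by
        refine Real.le_sqrt_of_sq_le ?_
        rw [mul_pow, Real.sq_sqrt (N.rho_nonneg hP0 _ r)]
        exact N.norm_sq_mul_rho_le hP0 (f, 0) r
      rw [norm_mul, norm_mul, Complex.norm_real, Real.norm_of_nonneg (Real.sqrt_nonneg _), mul_assoc]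
      calc ‖y j r‖ * (‖f r‖ * s r) ≤ 1 * Real.sqrt (N.p r / N.p0) :=
            mul_le_mul ((norm_le_pi_norm (y j) r).trans (hy j)) hs
              (mul_nonneg (norm_nonneg _) (Real.sqrt_nonneg _)) zero_le_one
        _ ≤ M := by
            rw [one_mul]
            exact Finset.single_le_sum (f := fun r => Real.sqrt (N.p r / N.p0))
              (fun r _ => Real.sqrt_nonneg _) (Finset.mem_univ r)
    · intro g hg j
      refine le_trans (le_of_eq ?_) (hg j)
      congr 1
      exact Finset.sum_congr rfl fun r _ => mul_right_comm _ _ _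
  have hreal : (c * ENNReal.ofReal ((1 / Real.sqrt P) ^ (2 * k))).toReal = c.toReal / P ^ k := by
    rw [ENNReal.toReal_mul, ENNReal.toReal_ofReal (by positivity), pow_mul, div_pow,
      Real.sq_sqrt hP0.le, one_pow, div_pow, one_pow, mul_one_div]
  rw [← hreal]
  exact ENNReal.toReal_mono (measure_ne_top _ _) key

/-- If every vector of the codebook is controlled by `k` vectors, then the symbol error rate decays
at most like `P ^ (-k)`. -/
theorem exists_le_ser (k : ℕ) (B : ℝ) :
    ∃ c : ℝ, 0 < c ∧ ∀ P : ℝ, 1 ≤ P → ∀ (C : Set (Beam R)) (q : Channel R → Beam R),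
      N.IsOptimalQuantizer P C q → ∀ y : Fin k → Beam R, (∀ j, ‖y j‖ ≤ 1) →
      (∀ x ∈ C, ∀ (w : Fin R → ℂ) (ε : ℝ), (∀ j, ‖∑ r, y j r * w r‖ ≤ ε) →
        ‖∑ r, x r * w r‖ ≤ B * ε) →
      c / P ^ k ≤ N.ser P q := by
  have h0 := N.p0_pos
  obtain ⟨c, hc, hle⟩ := N.exists_le_channelLaw k
  set t := gaussianTail (Real.sqrt (2 * (N.p0 * B ^ 2)))
  have ht : 0 < t := gaussianTail_pos _
  refine ⟨c * t, by positivity, fun P hP C q hq y hy hC => ?_⟩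
  have hP0 : 0 < P := one_pos.trans_le hP
  specialize hle P hP y hy
  set A := {h : Channel R | ∀ j,
        ‖∑ r, y j r * h.1 r * h.2 r * (Real.sqrt (N.rho P h r) : ℂ)‖ ≤ 1 / Real.sqrt P}
  have hA : A ⊆ {h | t ≤ gaussianTail (Real.sqrt (2 * N.snr P (q h) h))} := by
    intro h hh
    refine gaussianTail_antitone (Real.sqrt_le_sqrt ?_)
    refine mul_le_mul_of_nonneg_left ?_ two_pos.le
    have h1 := hC (q h) (hq h).1 (fun r => h.1 r * h.2 r * (Real.sqrt (N.rho P h r) : ℂ))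
      (1 / Real.sqrt P) (fun j => by simpa only [mul_assoc] using hh j)
    simp only [← mul_assoc] at h1
    calc N.snr P (q h) h ≤ _ := N.snr_le hP0 _ _
      _ ≤ (N.p0 * P) * (B * (1 / Real.sqrt P)) ^ 2 := by gcongr
      _ = N.p0 * B ^ 2 := by
        rw [mul_pow, div_pow, Real.sq_sqrt hP0.le]
        field_simp
  -- Markov's inequality, read as a lower bound for the SER.
  have hmarkov := mul_meas_ge_le_integral_of_nonneg
    (ae_of_all _ fun h => gaussianTail_nonneg _) (N.integrable_gaussianTail_snr hP0 hq) t
  calc c * t / P ^ k = t * (c / P ^ k) := by ring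
    _ ≤ t * N.channelLaw.real A := by gcongr
    _ ≤ _ := mul_le_mul_of_nonneg_left (measureReal_mono hA) ht.le
    _ ≤ _ := hmarkov

theorem upperDiversity_le_of_le_ser {q : ℝ → Channel R → Beam R} {c : ℝ} (hc : 0 < c) (k : ℕ)
    (h : ∀ P : ℝ, 1 ≤ P → c / P ^ k ≤ N.ser P (q P)) : N.upperDiversity q ≤ ((k : ℝ) : EReal) := by
  have hlim : Tendsto (fun P : ℝ => ((k - Real.log c / Real.log P : ℝ) : EReal)) atTop
      (𝓝 ((k : ℝ) : EReal)) := by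
    refine (continuous_coe_real_ereal.tendsto _).comp ?_
    simpa using (Real.tendsto_log_atTop.const_div_atTop (Real.log c)).const_sub (k : ℝ)
  rw [← hlim.limsup_eq]
  refine limsup_le_limsup ?_
  filter_upwards [eventually_gt_atTop 1] with P hP
  refine EReal.coe_le_coe_iff.2 ?_
  have hP0 : 0 < P := one_pos.trans hP
  have hlog : 0 < Real.log P := Real.log_pos hP
  have h1 := Real.log_le_log (by positivity) (h P hP.le)
  rw [Real.log_div hc.ne' (by positivity), Real.log_pow] at h1
  rw [div_le_iff₀ hlog, sub_mul, div_mul_cancel₀ _ hlog.ne']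
  linarith

end Network

/-! ### The two diversity bounds -/

/-- The diversity is at most the number of relays. -/
theorem upperDiversity_le_relays {R : ℕ} (N : Network R) (D : DCodebook R)
    {q : ℝ → Channel R → Beam R} (hq : IsOptimalCollection N D q) :
    N.upperDiversity q ≤ ((R : ℝ) : EReal) := by
  -- The basis vectors control each coordinate of `w`; summing `R` of them with `‖x r‖ ≤ 1` costs
  -- the factor `B = R`.
  obtain ⟨c, hc, h⟩ := N.exists_le_ser R R
  refine N.upperDiversity_le_of_le_ser hc R fun P hP => ?_
  have hP0 : 0 < P := one_pos.trans_le hP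
  refine h P hP (D.book P) (q P) (hq P hP0) (fun j => Pi.single j 1) (fun j => ?_) ?_
  · rw [Pi.norm_single, norm_one]
  · intro x hx w ε hw
    simp only [Pi.single_apply, ite_mul, one_mul, zero_mul, Finset.sum_ite_eq',
      Finset.mem_univ, if_true] at hw
    calc ‖∑ r, x r * w r‖ ≤ ∑ r, ‖x r * w r‖ := norm_sum_le _ _
      _ ≤ ∑ _r : Fin R, ε := Finset.sum_le_sum fun r _ => by
          rw [norm_mul]
          have h1 : ‖x r‖ ≤ 1 := (norm_le_pi_norm x r).trans_eq (D.norm_eq_one P hP0 x hx)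
          exact (mul_le_of_le_one_left (norm_nonneg _) h1).trans (hw r)
      _ = R * ε := by simp

/-- The diversity is at most the cardinality of a finite codebook. -/
theorem upperDiversity_le_card {R : ℕ} (N : Network R) (D : DCodebook R)
    {q : ℝ → Channel R → Beam R} (hq : IsOptimalCollection N D q) {k : ℕ} (hk : D.card = k) :
    N.upperDiversity q ≤ ((k : ℝ) : EReal) := by
  -- The codebook vectors control themselves, so `B = 1`.
  obtain ⟨c, hc, h⟩ := N.exists_le_ser k 1
  refine N.upperDiversity_le_of_le_ser hc k fun P hP => ?_
  have hP0 : 0 < P := one_pos.trans_le hP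
  have hcard : (D.book P).encard = k := (D.encard_eq P 1 hP0 one_pos).trans hk
  have : Finite (D.book P) := Set.finite_of_encard_eq_coe hcard
  have hn : Nat.card (D.book P) = k := by
    rw [Nat.card_coe_set_eq, Set.ncard, hcard, ENat.toNat_natCast]
  let e : D.book P ≃ Fin k := Finite.equivFinOfCardEq hn
  refine h P hP (D.book P) (q P) (hq P hP0) (fun j => (e.symm j : Beam R)) (fun j => ?_) ?_
  · exact (D.norm_eq_one P hP0 _ (e.symm j).2).le
  · intro x hx w ε hw
    simpa using hw (e ⟨x, hx⟩)

theorem coe_real_natCast_eq (k : ℕ) :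
    ((k : ℝ) : EReal) = (((k : ℕ∞) : ℝ≥0∞) : EReal) := by
  rw [ENat.toENNReal_coe]; rfl

theorem upperDiversity_le_min {R : ℕ} (N : Network R) (D : DCodebook R)
    {q : ℝ → Channel R → Beam R} (hq : IsOptimalCollection N D q) :
    N.upperDiversity q ≤ (((min (R : ℕ∞) D.card : ℕ∞) : ENNReal) : EReal) := by
  rcases min_choice (R : ℕ∞) D.card with h | h
  · rw [h]
    exact (upperDiversity_le_relays N D hq).trans_eq (coe_real_natCast_eq R)
  · rw [h]
    -- In this case the codebook is finite; an infinite one falls under the relay bound.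
    have hle : D.card ≤ R := min_eq_right_iff.1 h
    obtain ⟨k, hk⟩ := ENat.ne_top_iff_exists.1 (ne_top_of_le_ne_top (ENat.natCast_ne_top R) hle)
    rw [← hk]
    exact (upperDiversity_le_card N D hq hk.symm).trans_eq (coe_real_natCast_eq k)

end RelayBeamforming

end

theorem theorem4 {R : ℕ} (N : RelayBeamforming.Network R) (D : RelayBeamforming.DCodebook R)
    (q : ℝ → RelayBeamforming.Channel R → RelayBeamforming.Beam R)
    (hq : RelayBeamforming.IsOptimalCollection N D q) :
    N.upperDiversity q ≤ (((min (R : ℕ∞) D.card : ℕ∞) : ENNReal) : EReal) ∧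
      ∀ d : EReal, N.HasDiversity q d →
        d ≤ (((min (R : ℕ∞) D.card : ℕ∞) : ENNReal) : EReal) := by
  have h := RelayBeamforming.upperDiversity_le_min N D hq
  exact ⟨h, fun d hd => (Filter.Tendsto.limsup_eq hd).symm.trans_le h⟩
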